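/- Let $m,n\ge 0$ be integers and let $m$ balls be dropped independently, but not necessarily with identical distributions, into urns $1,\dots,n$: that is, $\sigma(1),\dots,\sigma(m)$ are independent random variables with values in $[n]=\{1,\dots,n\}$, whose laws may be arbitrary. For $S\subseteq[n]$ let $|\sigma^{-1}(S)|$ be the number of balls $i\in[m]$ with $\sigma(i)\in S$, and put $B_j=|\sigma^{-1}(\{j\})|$. For each $j\in[n]$ let $0=a_0(j)<a_1(j)<\dots<a_{k_j}(j)=m+1$ be integers. Let $[n]=I\cup J\cup K$ be a partition into pairwise disjoint (possibly empty) sets, let $t_j\in\{0,\dots,k_j-1\}$ for $j\in K$, and let $$Q=\{a_{t_j}(j)\le B_j<a_{t_j+1}(j)\ \text{ for all } j\in K\},$$ where $\Pr(Q)>0$. Let $Z=|\sigma^{-1}(I\cup J)|$. Then the conditional law of $Z$ given $Q$ is ultra-log-concave: with $r_i=\Pr(Z=i\mid Q)$ for $i\geq 0$, the sequence $\left(r_i/\binom{m}{i}\right)_{i=0}^m$ is log-concave, i.e. $$\left(\frac{r_i}{\binom mi}\right)^2\ \ge\ \frac{r_{i-1}}{\binom m{i-1}}\cdot\frac{r_{i+1}}{\binom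 m{i+1}}\qquad(1\le i\le m-1),$$ and has no internal zeros (if $0\le i<j<l\le m$ and $r_i,r_l\ne0$, then $r_j\neq0$). In particular, this law is strongly log-concave: $i\,r_i^2\ge (i+1)\,r_{i-1}r_{i+1}$ for all $i\ge1$. -/

import Mathlib

open MeasureTheory ProbabilityTheory

/-- The number of balls that land in the set `S` of urns, i.e. `|σ⁻¹(S)|`, when ball `i` is
dropped into urn `s i`. -/
def ballsIn {m n : ℕ} (s : Fin m → Fin n) (S : Finset (Fin n)) : ℕ :=
  (Finset.univ.filter fun i => s i ∈ S).card

/-- `a` is a sequence of breakpoints `0 = a 0 < a 1 < ⋯ < a k = m + 1`. -/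
structure IsBreakpoints (m : ℕ) {k : ℕ} (a : Fin (k + 1) → ℕ) : Prop where
  strictMono : StrictMono a
  zero : a 0 = 0
  last : a (Fin.last k) = m + 1

/-- Urn `j` is at level `t`: its number of balls `B_j` satisfies `a t ≤ B_j < a (t + 1)`. -/
def HasLevel {m n k : ℕ} (a : Fin (k + 1) → ℕ) (s : Fin m → Fin n) (j : Fin n) (t : Fin k) :
    Prop :=
  a t.castSucc ≤ ballsIn s {j} ∧ ballsIn s {j} < a t.succ

/-- The interval event `Q`: for every `j ∈ K`, urn `j` is at level `t j`. -/
def intervalEvent {Ω : Type*} {m n : ℕ} (σ : Fin m → Ω → Fin n) (K : Finset (Fin n))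
    {k : Fin n → ℕ} (a : ∀ j, Fin (k j + 1) → ℕ) (t : ∀ j, Fin (k j)) : Set Ω :=
  {ω | ∀ j ∈ K, HasLevel (a j) (fun i => σ i ω) j (t j)}

/-- The finite sequence `r 0, …, r m` has no internal zeros. -/
def NoInternalZeros (m : ℕ) (r : ℕ → ℝ) : Prop :=
  ∀ i j l : ℕ, i < j → j < l → l ≤ m → r i ≠ 0 → r l ≠ 0 → r j ≠ 0

/-- The finite sequence `r 0, …, r m` is log-concave. -/
def LogConcaveSeq (m : ℕ) (r : ℕ → ℝ) : Prop :=
  ∀ i : ℕ, 1 ≤ i → i + 1 ≤ m → r (i - 1) * r (i + 1) ≤ r i ^ 2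

/-- The law `ν` (of a random variable with values in `{0, …, m}`) is ultra-log-concave: the
sequence `ν {i} / C(m, i)`, `0 ≤ i ≤ m`, is log-concave and has no internal zeros. -/
def IsUltraLogConcave (m : ℕ) (ν : Measure ℕ) : Prop :=
  LogConcaveSeq m (fun i => ν.real {i} / (m.choose i : ℝ)) ∧
    NoInternalZeros m (fun i => ν.real {i} / (m.choose i : ℝ))

/-- The law `ν` on `ℕ` is strongly log-concave. -/
def IsStronglyLogConcave (ν : Measure ℕ) : Prop :=
  ∀ i : ℕ, 1 ≤ i →
    ((i : ℝ) + 1) * ν.real {i - 1} * ν.real {i + 1} ≤ (i : ℝ) * ν.real {i} ^ 2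

/-!
The loads of the urns have the joint generating polynomial `∏ᵢ (∑ⱼ p i j * xⱼ)`, and the proof
shows that restricting the exponents of a product of nonnegative linear forms to a box leaves a
Lorentzian polynomial: every iterated directional derivative of degree two, in nonnegative
directions, has at most one positive eigenvalue. Let `z` and `y` be the indicator vectors of `I ∪ J`
and of `K`. Differentiating the restricted polynomial `i` times in direction `z` and `m - i` times
in direction `y` gives `i! (m - i)! ℙ(Q, Z = i)`, which is `rᵢ / C(m, i)` up to a factor
independent of `i`; the reversed Cauchy–Schwarz inequality for the quadratic form that is left
after `m - 2` of these derivatives is ultra-log-concavity.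

The Lorentzian property is checked on coordinate derivatives and passed on to all positive
directions by the trickle-down argument (`Matrix.isLorentzian_sum_smul`,
`LorentzianCoeffs.derivative`). That argument is simplest when all coefficients are positive, so
everything is deformed by a parameter `ε > 0`. The starting point is the exponential of a sum of
variables, one for each ball, all of whose coefficients are `1`. Multiplying coefficients by
log-concave functions of the exponents keeps the property, as it only rescales the Hessians and
lowers their diagonals (`LorentzianCoeffs.mul_prod`). This is used for the balls, with weights
`ε ^ (k - 1)` that leave the product of the variables as `ε → 0`; then come a positive linear
substitution (`LorentzianCoeffs.comp`) and weights `ε ^ d` for the urns in `K`, where `d` is the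
distance of the load to the prescribed interval. The limit `ε → 0` is `levelWeight_mul_le_sq`.

The absence of internal zeros does not survive the limit and is proved by exchanging balls between
two admissible assignments (`exists_isAdmissible_ballsIn_eq`).
-/

/-! ### Quadratic forms with at most one positive eigenvalue -/

section Lorentz

open Matrix

variable {ι κ : Type*} [Fintype ι] [Fintype κ]

/-- The quadratic form of the real matrix `M` has at most one positive eigenvalue: it is
nonpositive on the kernel of some linear functional. -/
def Matrix.IsLorentzian (M : Matrix ι ι ℝ) : Prop :=
  ∃ φ : (ι → ℝ) →ₗ[ℝ] ℝ, ∀ w, φ w = 0 → w ⬝ᵥ M *ᵥ w ≤ 0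

/-- The reversed Cauchy–Schwarz inequality. -/
theorem Matrix.IsLorentzian.mul_le_sq {M : Matrix ι ι ℝ} (hM : M.IsLorentzian) (hsymm : M.IsSymm)
    {u : ι → ℝ} (hu : 0 < u ⬝ᵥ M *ᵥ u) (v : ι → ℝ) :
    (u ⬝ᵥ M *ᵥ u) * (v ⬝ᵥ M *ᵥ v) ≤ (u ⬝ᵥ M *ᵥ v) ^ 2 := by
  obtain ⟨φ, hφ⟩ := hM
  have hne : φ u ≠ 0 := fun h => absurd (hφ u h) (not_le.2 hu)
  have hcomm : v ⬝ᵥ M *ᵥ u = u ⬝ᵥ M *ᵥ v := by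
    rw [dotProduct_mulVec, ← mulVec_transpose, hsymm.eq, dotProduct_comm]
  -- a combination of `u` and `v` in the kernel of `φ`, with nonzero coefficient at `v`
  have h := hφ (φ v • u - φ u • v) (by simp [mul_comm])
  simp only [mulVec_sub, mulVec_smul, sub_dotProduct, dotProduct_sub, smul_dotProduct,
    dotProduct_smul, smul_eq_mul, hcomm] at h
  set a := u ⬝ᵥ M *ᵥ u
  set b := u ⬝ᵥ M *ᵥ v
  set c := v ⬝ᵥ M *ᵥ v
  by_contra hcon
  have h1 : 0 < φ u ^ 2 * (a * c - b ^ 2) := mul_pos (by positivity) (by linarith)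
  nlinarith [sq_nonneg (φ v * a - φ u * b), mul_nonneg hu.le (sub_nonneg.2 h)]

theorem Matrix.IsLorentzian.of_le {M N : Matrix ι ι ℝ} (hM : M.IsLorentzian)
    (h : ∀ w, w ⬝ᵥ N *ᵥ w ≤ w ⬝ᵥ M *ᵥ w) : N.IsLorentzian :=
  let ⟨φ, hφ⟩ := hM
  ⟨φ, fun w hw => (h w).trans (hφ w hw)⟩

theorem Matrix.IsLorentzian.smul {M : Matrix ι ι ℝ} (hM : M.IsLorentzian) {r : ℝ} (hr : 0 ≤ r) :
    (r • M).IsLorentzian := by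
  obtain ⟨φ, hφ⟩ := hM
  refine ⟨φ, fun w hw => ?_⟩
  rw [smul_mulVec, dotProduct_smul, smul_eq_mul]
  exact mul_nonpos_of_nonneg_of_nonpos hr (hφ w hw)

/-- Lorentzian matrices pull back along linear maps. -/
theorem Matrix.IsLorentzian.conj {M : Matrix ι ι ℝ} (hM : M.IsLorentzian) (P : Matrix ι κ ℝ) :
    (Pᵀ * M * P).IsLorentzian := by
  obtain ⟨φ, hφ⟩ := hM
  refine ⟨φ ∘ₗ P.mulVecLin, fun w hw => ?_⟩
  have := hφ (P *ᵥ w) hw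
  rwa [← mulVec_mulVec, ← mulVec_mulVec, dotProduct_mulVec, vecMul_transpose]

theorem Matrix.isLorentzian_allOnes : (Matrix.of fun _ _ : ι => (1 : ℝ)).IsLorentzian := by
  refine ⟨∑ i, LinearMap.proj i, fun w hw => ?_⟩
  simp only [LinearMap.coe_sum, Finset.sum_apply, LinearMap.coe_proj, Function.eval] at hw
  simp [dotProduct, mulVec, hw]

/-! ### The trickle-down argument -/

/-- The Laplacian identity: for a symmetric matrix, the deficit of the quadratic form against its
row sums is a weighted sum of squared differences. -/
theorem Matrix.IsSymm.sum_mul_sub_sq {H : Matrix ι ι ℝ} (hH : H.IsSymm) (x y : ι → ℝ) :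
    ∑ i, ∑ j, H i j * x i * x j * (y i - y j) ^ 2 =
      2 * (∑ i, (H *ᵥ x) i * x i * y i ^ 2 -
        (fun i => x i * y i) ⬝ᵥ H *ᵥ (fun i => x i * y i)) := by
  have h1 : ∑ i, ∑ j, H i j * x i * x j * y j ^ 2 = ∑ i, ∑ j, H i j * x i * x j * y i ^ 2 := by
    rw [Finset.sum_comm]
    refine Finset.sum_congr rfl fun i _ => Finset.sum_congr rfl fun j _ => ?_
    rw [hH.apply]; ring
  have h2 : ∑ i, (H *ᵥ x) i * x i * y i ^ 2 = ∑ i, ∑ j, H i j * x i * x j * y i ^ 2 := by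
    refine Finset.sum_congr rfl fun i _ => ?_
    rw [mulVec, dotProduct, Finset.sum_mul, Finset.sum_mul]
    exact Finset.sum_congr rfl fun j _ => by ring
  have h3 : (fun i => x i * y i) ⬝ᵥ H *ᵥ (fun i => x i * y i) =
      ∑ i, ∑ j, H i j * x i * x j * (y i * y j) := by
    refine Finset.sum_congr rfl fun i _ => ?_
    rw [mulVec, dotProduct, Finset.mul_sum]
    exact Finset.sum_congr rfl fun j _ => by ring
  have h4 : ∀ i j, H i j * x i * x j * (y i - y j) ^ 2 = H i j * x i * x j * y i ^ 2 +
      H i j * x i * x j * y j ^ 2 - 2 * (H i j * x i * x j * (y i * y j)) := fun i j => by ring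
  simp only [h4, Finset.sum_sub_distrib, Finset.sum_add_distrib, ← Finset.mul_sum]
  rw [h1, h2, h3]
  ring

/-- The spectral core of the trickle-down argument. Let `D` be the diagonal matrix with entries
`(H x)ᵢ / xᵢ`. The hypothesis says `A ≤ A²` for the operator `A = D⁻¹ H`, which is self-adjoint for
the inner product of `D`, so its eigenvalues avoid the interval `(0, 1)`; by positivity the only
eigenvectors with eigenvalue at least `1` are the multiples of `x`. -/
theorem Matrix.dotProduct_mulVec_nonpos_of_gap {H : Matrix ι ι ℝ} (hH : H.IsSymm)
    (hpos : ∀ i j, 0 < H i j) {x : ι → ℝ} (hx : ∀ i, 0 < x i)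
    (hgap : ∀ y, y ⬝ᵥ H *ᵥ y ≤ ∑ i, x i * (H *ᵥ y) i ^ 2 / (H *ᵥ x) i)
    {y : ι → ℝ} (hy : x ⬝ᵥ H *ᵥ y = 0) : y ⬝ᵥ H *ᵥ y ≤ 0 := by
  classical
  have hHx : ∀ i, 0 < (H *ᵥ x) i := fun i =>
    Finset.sum_pos (fun j _ => mul_pos (hpos i j) (hx j)) ⟨i, Finset.mem_univ i⟩
  set d : ι → ℝ := fun i => (H *ᵥ x) i / x i with hd
  have hdpos : ∀ i, 0 < d i := fun i => div_pos (hHx i) (hx i)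
  set s : ι → ℝ := fun i => √(d i) with hs
  have hspos : ∀ i, 0 < s i := fun i => Real.sqrt_pos.2 (hdpos i)
  have hs2 : ∀ i, s i ^ 2 = d i := fun i => Real.sq_sqrt (hdpos i).le
  set B : Matrix ι ι ℝ := Matrix.of fun i j => H i j / (s i * s j) with hB
  have hBherm : B.IsHermitian := by
    ext i j
    simp [hB, hH.apply i j, mul_comm]
  have hBmul : ∀ (g : ι → ℝ) i, (B *ᵥ g) i = (H *ᵥ fun j => g j / s j) i / s i := by
    intro g i
    simp only [mulVec, dotProduct, hB, Matrix.of_apply, Finset.sum_div]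
    refine Finset.sum_congr rfl fun j _ => ?_
    have := (hspos i).ne'; have := (hspos j).ne'
    field_simp
  have hBform : ∀ g : ι → ℝ, g ⬝ᵥ B *ᵥ g =
      (fun j => g j / s j) ⬝ᵥ H *ᵥ (fun j => g j / s j) := by
    intro g
    refine Finset.sum_congr rfl fun i _ => ?_
    rw [hBmul]; ring
  have heig : ∀ k, hBherm.eigenvalues k ≤ 0 ∨
      ∃ r : ℝ, ∀ i, (hBherm.eigenvectorBasis k) i = r * (s i * x i) := by
    intro k
    set g : ι → ℝ := ⇑(hBherm.eigenvectorBasis k) with hg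
    set lam := hBherm.eigenvalues k
    have hBg : B *ᵥ g = lam • g := hBherm.mulVec_eigenvectorBasis k
    have hnorm : ∑ i, g i ^ 2 = 1 := by
      have := hBherm.eigenvectorBasis.orthonormal.1 k
      rw [EuclideanSpace.norm_eq, Real.sqrt_eq_one] at this
      simpa using this
    have hform : g ⬝ᵥ B *ᵥ g = lam := by
      rw [hBg, dotProduct_smul, smul_eq_mul, dotProduct]
      simp only [← sq, hnorm, mul_one]
    have hle : lam ≤ lam ^ 2 := by
      have h1 := hgap fun j => g j / s j
      rw [← hBform, hform] at h1
      refine h1.trans_eq ?_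
      calc _ = ∑ i, (B *ᵥ g) i ^ 2 := by
            refine Finset.sum_congr rfl fun i _ => ?_
            rw [hBmul, div_pow, hs2, hd]
            have := (hx i).ne'; have := (hHx i).ne'
            field_simp
        _ = lam ^ 2 := by
            simp only [hBg, Pi.smul_apply, smul_eq_mul, mul_pow, ← Finset.mul_sum, hnorm, mul_one]
    rcases le_or_gt lam 0 with h0 | h0
    · exact Or.inl h0
    right
    have h1 : 1 ≤ lam := by nlinarith
    set z : ι → ℝ := fun i => g i / (s i * x i) with hz
    have hzx : (fun i => x i * z i) = fun i => g i / s i := by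
      funext i
      have := (hx i).ne'; have := (hspos i).ne'
      simp only [hz]; field_simp
    have hlap := hH.sum_mul_sub_sq x z
    rw [hzx, ← hBform, hform] at hlap
    have h2 : ∑ i, (H *ᵥ x) i * x i * z i ^ 2 = 1 := by
      rw [← hnorm]
      refine Finset.sum_congr rfl fun i _ => ?_
      have := (hx i).ne'; have := (hHx i).ne'
      simp only [hz, div_pow, mul_pow, hs2, hd]
      field_simp
    have hterm : ∀ i j, 0 ≤ H i j * x i * x j * (z i - z j) ^ 2 := fun i j =>
      mul_nonneg (mul_nonneg (mul_nonneg (hpos i j).le (hx i).le) (hx j).le) (sq_nonneg _)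
    have h3 : ∑ i, ∑ j, H i j * x i * x j * (z i - z j) ^ 2 = 0 := by
      refine le_antisymm (by rw [hlap, h2]; linarith) ?_
      exact Finset.sum_nonneg fun i _ => Finset.sum_nonneg fun j _ => hterm i j
    have hconst : ∀ i j, z i = z j := by
      intro i j
      rw [Finset.sum_eq_zero_iff_of_nonneg
        fun i _ => Finset.sum_nonneg fun j _ => hterm i j] at h3
      have h4 := h3 i (Finset.mem_univ i)
      rw [Finset.sum_eq_zero_iff_of_nonneg fun j _ => hterm i j] at h4
      have h5 := h4 j (Finset.mem_univ j)
      have h6 : H i j * x i * x j ≠ 0 := (mul_pos (mul_pos (hpos i j) (hx i)) (hx j)).ne'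
      have h7 : (z i - z j) ^ 2 = 0 := (mul_eq_zero.1 h5).resolve_left h6
      linarith [pow_eq_zero_iff (two_ne_zero) |>.1 h7]
    refine ⟨z k, fun i => ?_⟩
    rw [hconst k i]
    have := (hx i).ne'; have := (hspos i).ne'
    change g i = _
    simp only [hz]; field_simp
  -- expand `g = D^{1/2} y` in the eigenbasis; it is orthogonal to `D^{1/2} x`
  set g : EuclideanSpace ℝ ι := WithLp.toLp 2 fun i => s i * y i with hg
  have hyg : (fun j => g j / s j) = y := by
    funext j
    have := (hspos j).ne'
    simp only [hg]; field_simp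
  rw [← hyg, ← hBform]
  have hexp : g.ofLp ⬝ᵥ B *ᵥ g.ofLp =
      ∑ k, hBherm.eigenvalues k * inner ℝ (hBherm.eigenvectorBasis k) g ^ 2 := by
    have h1 : g.ofLp ⬝ᵥ B *ᵥ g.ofLp = inner ℝ g (WithLp.toLp 2 (B *ᵥ g.ofLp)) := by
      simp [EuclideanSpace.inner_eq_star_dotProduct, dotProduct_comm]
    rw [h1, ← hBherm.eigenvectorBasis.sum_inner_mul_inner]
    refine Finset.sum_congr rfl fun k _ => ?_
    have h2 : inner ℝ (hBherm.eigenvectorBasis k) (WithLp.toLp 2 (B *ᵥ g.ofLp)) =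
        hBherm.eigenvalues k * inner ℝ (hBherm.eigenvectorBasis k) g := by
      simp only [EuclideanSpace.inner_eq_star_dotProduct, star_trivial]
      rw [dotProduct_comm, dotProduct_mulVec, ← mulVec_transpose,
        show Bᵀ = B by simpa using hBherm.eq, hBherm.mulVec_eigenvectorBasis, smul_dotProduct,
        smul_eq_mul, dotProduct_comm]
    rw [h2, real_inner_comm]; ring
  rw [hexp]
  refine Finset.sum_nonpos fun k _ => ?_
  rcases heig k with h | ⟨r, hr⟩
  · exact mul_nonpos_of_nonpos_of_nonneg h (sq_nonneg _)
  · have h0 : inner ℝ (hBherm.eigenvectorBasis k) g = 0 := by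
      have h1 : inner ℝ (hBherm.eigenvectorBasis k) g = r * ((H *ᵥ x) ⬝ᵥ y) := by
        simp only [EuclideanSpace.inner_eq_star_dotProduct, star_trivial, dotProduct,
          Finset.mul_sum]
        refine Finset.sum_congr rfl fun i _ => ?_
        have h2 : s i * s i = d i := by rw [← sq, hs2]
        have := (hx i).ne'
        calc s i * y i * (hBherm.eigenvectorBasis k) i = r * (s i * s i * x i * y i) := by
              rw [hr]; ring
          _ = r * ((H *ᵥ x) i * y i) := by
              rw [h2, hd]; field_simp
      rw [h1, ← hH.eq, mulVec_transpose, ← dotProduct_mulVec, hy, mul_zero]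
    simp [h0]

/-- A positive symmetric `3`-tensor all of whose slices are Lorentzian has Lorentzian contractions
with positive vectors. Cauchy–Schwarz in every slice `G l`, applied to `x` and `y`, adds up to the
gap inequality for the contraction. -/
theorem Matrix.isLorentzian_sum_smul {G : ι → Matrix ι ι ℝ} (hpos : ∀ l i j, 0 < G l i j)
    (h12 : ∀ l i j, G l i j = G i l j) (h23 : ∀ l i j, G l i j = G l j i)
    (hG : ∀ l, (G l).IsLorentzian) {x : ι → ℝ} (hx : ∀ i, 0 < x i) :
    (∑ l, x l • G l).IsLorentzian := by
  set H := ∑ l, x l • G l with hHdef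
  have happ : ∀ i j, H i j = ∑ l, x l * G l i j := by
    intro i j; simp [hHdef, Matrix.sum_apply]
  have hH : H.IsSymm := by
    ext i j
    simp only [transpose_apply, happ]
    exact Finset.sum_congr rfl fun l _ => by rw [h23]
  have hHpos : ∀ i j, 0 < H i j := fun i j => by
    rw [happ]
    exact Finset.sum_pos (fun l _ => mul_pos (hx l) (hpos l i j)) ⟨i, Finset.mem_univ i⟩
  have hHx : ∀ i, 0 < (H *ᵥ x) i := fun i =>
    Finset.sum_pos (fun j _ => mul_pos (hHpos i j) (hx j)) ⟨i, Finset.mem_univ i⟩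
  have hslice : ∀ l y, x ⬝ᵥ G l *ᵥ y = (H *ᵥ y) l := by
    intro l y
    rw [dotProduct_mulVec]
    refine Finset.sum_congr rfl fun j _ => ?_
    change (∑ i, x i * G l i j) * y j = H l j * y j
    rw [happ]
    simp only [h12 l]
  have hsum : ∀ y, y ⬝ᵥ H *ᵥ y = ∑ l, x l * (y ⬝ᵥ G l *ᵥ y) := by
    intro y
    simp [hHdef, sum_mulVec, dotProduct_sum, smul_mulVec]
  refine ⟨LinearMap.mk ⟨fun y => x ⬝ᵥ H *ᵥ y, fun y z => by simp [mulVec_add, dotProduct_add]⟩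
    fun r y => by simp [mulVec_smul], fun y hy => ?_⟩
  refine dotProduct_mulVec_nonpos_of_gap hH hHpos hx (fun y => ?_) hy
  rw [hsum]
  refine Finset.sum_le_sum fun l _ => ?_
  have hGs : (G l).IsSymm := by ext i j; exact h23 l j i
  have hxx : 0 < x ⬝ᵥ G l *ᵥ x := by rw [hslice]; exact hHx l
  have h1 := (hG l).mul_le_sq hGs hxx y
  rw [hslice, hslice] at h1
  rw [mul_div_assoc]
  refine mul_le_mul_of_nonneg_left ?_ (hx l).le
  rw [le_div_iff₀ (hHx l)]
  linarith

end Lorentz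

/-! ### Lorentzian coefficient functions -/

section Coefficients

open Matrix

variable {ι κ : Type*} [Fintype ι] [Fintype κ]

/-- A function `c` on multisets of variables stands for the power series `∑ c(s) xˢ / s!`. Its
derivative in direction `v` has the coefficients `s ↦ ∑ i, v i * c (i ::ₘ s)`. -/
noncomputable def dirDeriv (v : ι → ℝ) (c : Multiset ι → ℝ) : Multiset ι → ℝ :=
  fun s => ∑ i, v i * c (i ::ₘ s)

instance : LeftCommutative (dirDeriv (ι := ι)) where
  left_comm u v c := by
    funext s
    simp only [dirDeriv, Finset.mul_sum]
    rw [Finset.sum_comm]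
    refine Finset.sum_congr rfl fun i _ => Finset.sum_congr rfl fun j _ => ?_
    rw [Multiset.cons_swap]; ring

/-- The second derivatives `(i, j) ↦ c (i ::ₘ j ::ₘ s)` of the series with coefficients `c`. -/
def hessianAt (c : Multiset ι → ℝ) (s : Multiset ι) : Matrix ι ι ℝ :=
  Matrix.of fun i j => c (i ::ₘ j ::ₘ s)

theorem hessianAt_isSymm {α : Type*} (c : Multiset α → ℝ) (s : Multiset α) :
    (hessianAt c s).IsSymm := by
  ext i j
  exact congrArg c (Multiset.cons_swap j i s)

theorem dirDeriv_dirDeriv (u v : ι → ℝ) (c : Multiset ι → ℝ) (s : Multiset ι) :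
    dirDeriv u (dirDeriv v c) s = u ⬝ᵥ hessianAt c s *ᵥ v := by
  refine Finset.sum_congr rfl fun i _ => ?_
  congr 1
  refine Finset.sum_congr rfl fun j _ => ?_
  change v j * c (j ::ₘ i ::ₘ s) = c (i ::ₘ j ::ₘ s) * v j
  rw [mul_comm, Multiset.cons_swap]

/-- All coefficients are positive and all iterated partial derivatives, in all degrees, have
quadratic parts with at most one positive eigenvalue. -/
structure LorentzianCoeffs (c : Multiset ι → ℝ) : Prop where
  pos : ∀ s, 0 < c s
  hessian : ∀ s, (hessianAt c s).IsLorentzian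

theorem lorentzianCoeffs_one : LorentzianCoeffs fun _ : Multiset ι => (1 : ℝ) :=
  ⟨fun _ => one_pos, fun _ => Matrix.isLorentzian_allOnes⟩

/-- The local-to-global principle: from coordinate directions to all positive directions. -/
theorem LorentzianCoeffs.derivative [Nonempty ι] {c : Multiset ι → ℝ} (hc : LorentzianCoeffs c)
    {v : ι → ℝ} (hv : ∀ i, 0 < v i) : LorentzianCoeffs (dirDeriv v c) := by
  refine ⟨fun s => Finset.sum_pos (fun i _ => mul_pos (hv i) (hc.pos _)) Finset.univ_nonempty,
    fun s => ?_⟩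
  have h : hessianAt (dirDeriv v c) s = ∑ l, v l • hessianAt c (l ::ₘ s) := by
    ext i j
    simp only [hessianAt, Matrix.of_apply, dirDeriv, Matrix.sum_apply, Matrix.smul_apply,
      smul_eq_mul]
    refine Finset.sum_congr rfl fun l _ => ?_
    rw [Multiset.cons_swap l i, Multiset.cons_swap l j]
  rw [h]
  refine Matrix.isLorentzian_sum_smul (fun l i j => hc.pos _) (fun l i j => ?_) (fun l i j => ?_)
    (fun l => hc.hessian _) hv
  · rw [Multiset.cons_swap i j, Multiset.cons_swap i l, Multiset.cons_swap l j]
  · exact congrArg c (Multiset.cons_swap i j _)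

theorem LorentzianCoeffs.iteratedDerivative [Nonempty ι] {c : Multiset ι → ℝ}
    (hc : LorentzianCoeffs c) (vs : Multiset (ι → ℝ)) (hvs : ∀ v ∈ vs, ∀ i, 0 < v i) :
    LorentzianCoeffs (vs.foldr dirDeriv c) := by
  induction vs using Multiset.induction_on with
  | empty => exact hc
  | cons v vs ih =>
    rw [Multiset.foldr_cons]
    exact (ih fun u hu => hvs u (Multiset.mem_cons_of_mem hu)).derivative
      (hvs v (Multiset.mem_cons_self v vs))

/-- The Alexandrov–Fenchel inequality for mixed derivatives in two positive directions. -/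
theorem LorentzianCoeffs.mul_le_sq [Nonempty ι] {c : Multiset ι → ℝ} (hc : LorentzianCoeffs c)
    {z y : ι → ℝ} (hz : ∀ i, 0 < z i) (hy : ∀ i, 0 < y i) (a b : ℕ) :
    (Multiset.replicate a z + Multiset.replicate (b + 2) y).foldr dirDeriv c 0 *
      (Multiset.replicate (a + 2) z + Multiset.replicate b y).foldr dirDeriv c 0 ≤
    (Multiset.replicate (a + 1) z + Multiset.replicate (b + 1) y).foldr dirDeriv c 0 ^ 2 := by
  set C := (Multiset.replicate a z + Multiset.replicate b y).foldr dirDeriv c with hC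
  have hCL : LorentzianCoeffs C := hc.iteratedDerivative _ fun v hv => by
    rcases Multiset.mem_add.1 hv with h | h
    · rwa [Multiset.eq_of_mem_replicate h]
    · rwa [Multiset.eq_of_mem_replicate h]
  have h1 : (Multiset.replicate a z + Multiset.replicate (b + 2) y).foldr dirDeriv c =
      dirDeriv y (dirDeriv y C) := by
    simp only [hC, Multiset.replicate_succ, Multiset.add_cons, Multiset.foldr_cons]
  have h2 : (Multiset.replicate (a + 2) z + Multiset.replicate b y).foldr dirDeriv c =
      dirDeriv z (dirDeriv z C) := by
    simp only [hC, Multiset.replicate_succ, Multiset.cons_add, Multiset.foldr_cons]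
  have h3 : (Multiset.replicate (a + 1) z + Multiset.replicate (b + 1) y).foldr dirDeriv c =
      dirDeriv y (dirDeriv z C) := by
    simp only [hC, Multiset.replicate_succ, Multiset.cons_add, Multiset.add_cons,
      Multiset.foldr_cons]
  rw [h1, h2, h3, dirDeriv_dirDeriv, dirDeriv_dirDeriv, dirDeriv_dirDeriv]
  refine (hCL.hessian 0).mul_le_sq (hessianAt_isSymm C 0) ?_ z
  rw [← dirDeriv_dirDeriv]
  exact ((hCL.derivative hy).derivative hy).pos 0

theorem Matrix.IsLorentzian.of_diag_le {M N : Matrix ι ι ℝ} (hM : M.IsLorentzian)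
    (hoff : ∀ i j, i ≠ j → N i j = M i j) (hdiag : ∀ i, N i i ≤ M i i) : N.IsLorentzian := by
  refine hM.of_le fun w => ?_
  refine Finset.sum_le_sum fun i _ => ?_
  rw [mulVec, mulVec, dotProduct, dotProduct, Finset.mul_sum, Finset.mul_sum]
  refine Finset.sum_le_sum fun j _ => ?_
  rcases eq_or_ne i j with rfl | h
  · nlinarith [mul_le_mul_of_nonneg_right (hdiag i) (mul_self_nonneg (w i))]
  · rw [hoff i j h]

theorem prod_weight_count_cons [DecidableEq ι] {w : ι → ℕ → ℝ} (hw : ∀ l k, 0 < w l k) (i : ι)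
    (s : Multiset ι) : ∏ l, w l ((i ::ₘ s).count l) =
      (∏ l, w l (s.count l)) * (w i (s.count i + 1) / w i (s.count i)) := by
  rw [← Finset.mul_prod_erase _ _ (Finset.mem_univ i),
    ← Finset.mul_prod_erase _ (fun l => w l (s.count l)) (Finset.mem_univ i),
    Multiset.count_cons_self,
    Finset.prod_congr rfl (fun l hl => by
      rw [Multiset.count_cons_of_ne (Finset.ne_of_mem_erase hl)] :
      ∀ l ∈ Finset.univ.erase i, w l ((i ::ₘ s).count l) = w l (s.count l))]
  have := (hw i (s.count i)).ne'
  field_simp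

/-- Multiplying coefficients by positive log-concave functions of the exponents preserves the
Lorentzian property: a Hessian is rescaled and its diagonal entries become smaller. -/
theorem LorentzianCoeffs.mul_prod [DecidableEq ι] {c : Multiset ι → ℝ} (hc : LorentzianCoeffs c)
    {w : ι → ℕ → ℝ} (hw : ∀ l k, 0 < w l k)
    (hlc : ∀ l k, w l k * w l (k + 2) ≤ w l (k + 1) ^ 2) :
    LorentzianCoeffs fun s => c s * ∏ l, w l (s.count l) := by
  refine ⟨fun s => mul_pos (hc.pos s) (Finset.prod_pos fun l _ => hw l _), fun s => ?_⟩
  set q : ι → ℝ := fun i => w i (s.count i + 1) / w i (s.count i) with hq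
  have hM := ((hc.hessian s).conj (diagonal q)).smul
    (Finset.prod_nonneg fun l _ => (hw l (s.count l)).le : 0 ≤ ∏ l, w l (s.count l))
  refine hM.of_diag_le (fun i j hij => ?_) fun i => ?_
  · simp only [hessianAt, Matrix.of_apply, Matrix.smul_apply, smul_eq_mul, diagonal_transpose,
      mul_diagonal, diagonal_mul]
    rw [prod_weight_count_cons hw, prod_weight_count_cons hw, Multiset.count_cons_of_ne hij]
    ring
  · simp only [hessianAt, Matrix.of_apply, Matrix.smul_apply, smul_eq_mul, diagonal_transpose,
      mul_diagonal, diagonal_mul]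
    rw [prod_weight_count_cons hw, prod_weight_count_cons hw, Multiset.count_cons_self]
    have h1 : w i (s.count i + 1 + 1) / w i (s.count i + 1) ≤ q i := by
      rw [hq, div_le_div_iff₀ (hw _ _) (hw _ _)]
      linarith [hlc i (s.count i)]
    have h2 : 0 ≤ c (i ::ₘ i ::ₘ s) * (∏ l, w l (s.count l)) * q i :=
      mul_nonneg (mul_nonneg (hc.pos _).le (Finset.prod_nonneg fun l _ => (hw l _).le))
        (div_pos (hw _ _) (hw _ _)).le
    have h3 := mul_le_mul_of_nonneg_left h1 h2
    simp only [hq] at h3 ⊢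
    linarith

/-- A positive linear change of variables: the series `x ↦ f(∑ j, x j • p j)` is Lorentzian if `f`
is. -/
theorem LorentzianCoeffs.comp [Nonempty ι] {c : Multiset ι → ℝ} (hc : LorentzianCoeffs c)
    {p : κ → ι → ℝ} (hp : ∀ j i, 0 < p j i) :
    LorentzianCoeffs fun s : Multiset κ => (s.map p).foldr dirDeriv c 0 := by
  have hL : ∀ s : Multiset κ, LorentzianCoeffs ((s.map p).foldr dirDeriv c) := fun s =>
    hc.iteratedDerivative _ fun v hv => by
      obtain ⟨j, -, rfl⟩ := Multiset.mem_map.1 hv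
      exact hp j
  refine ⟨fun s => (hL s).pos 0, fun s => ?_⟩
  convert ((hL s).hessian 0).conj (Matrix.of fun i j => p j i) using 1
  ext i j
  rw [hessianAt, Matrix.of_apply, Multiset.map_cons, Multiset.map_cons, Multiset.foldr_cons,
    Multiset.foldr_cons, dirDeriv_dirDeriv, dotProduct_mulVec, Matrix.mul_apply]
  rfl

/-- Iterated derivatives at the origin, expanded in coordinates. -/
theorem foldr_dirDeriv_eq_sum (c : Multiset ι → ℝ) (m : ℕ) (v : Fin m → ι → ℝ)
    (t : Multiset ι) :
    ((Finset.univ : Finset (Fin m)).val.map v).foldr dirDeriv c t =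
      ∑ s : Fin m → ι, (∏ k, v k (s k)) * c ((Finset.univ : Finset (Fin m)).val.map s + t) := by
  induction m generalizing t with
  | zero => simp
  | succ m ih =>
    rw [Fin.univ_succ, Finset.cons_val, Multiset.map_cons, Multiset.foldr_cons, Finset.map_val,
      Multiset.map_map]
    rw [← (Fin.consEquiv fun _ : Fin (m + 1) => ι).sum_comp, Fintype.sum_prod_type, dirDeriv]
    refine Finset.sum_congr rfl fun i _ => ?_
    rw [show (v ∘ ⇑(⟨Fin.succ, Fin.succ_injective m⟩ : Fin m ↪ Fin (m + 1))) =
      fun k => v k.succ from rfl, ih, Finset.mul_sum]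
    refine Finset.sum_congr rfl fun s _ => ?_
    simp only [Fin.consEquiv, Equiv.coe_fn_mk, Finset.prod_cons, Finset.prod_map,
      Function.Embedding.coeFn_mk, Fin.cons_zero, Fin.cons_succ, Multiset.map_cons,
      Multiset.map_map, Function.comp_def, mul_assoc, Multiset.cons_add, Multiset.add_cons]

end Coefficients

/-! ### Permutations carrying an initial segment onto a given set -/

theorem card_perm_iff_mem_eq_of_card_eq {m : ℕ} (i : ℕ) {A B : Finset (Fin m)}
    (h : A.card = B.card) :
    (Finset.univ.filter fun b : Equiv.Perm (Fin m) => ∀ k, k.val < i ↔ b k ∈ A).card =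
      (Finset.univ.filter fun b : Equiv.Perm (Fin m) => ∀ k, k.val < i ↔ b k ∈ B).card := by
  let e : {x // x ∈ A} ≃ {x // x ∈ B} := Finset.equivOfCardEq h
  have he : ∀ x, e.extendSubtype x ∈ B ↔ x ∈ A := fun x =>
    ⟨fun hx => by_contra fun hn => e.extendSubtype_not_mem x hn hx, e.extendSubtype_mem x⟩
  refine Finset.card_bijective (Equiv.mulLeft e.extendSubtype) (Equiv.bijective _) fun b => ?_
  simp [he]

theorem choose_mul_card_perm_iff_mem {m i : ℕ} (hi : i ≤ m) {A : Finset (Fin m)}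
    (hA : A.card = i) :
    m.choose i * (Finset.univ.filter fun b : Equiv.Perm (Fin m) =>
      ∀ k, k.val < i ↔ b k ∈ A).card = m.factorial := by
  set L : Finset (Fin m) := Finset.univ.filter fun k => k.val < i
  have hL : L.card = i := by
    simp only [L]
    rw [Fin.card_filter_val_lt, min_eq_right hi]
  have h := Finset.card_eq_sum_card_fiberwise (s := (Finset.univ : Finset (Equiv.Perm (Fin m))))
    (t := Finset.powersetCard i Finset.univ) (f := fun b => L.map b.toEmbedding)
    (fun b _ => by simp [Finset.mem_powersetCard, hL])
  rw [Finset.card_univ, Fintype.card_perm, Fintype.card_fin] at h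
  rw [h, Finset.sum_congr rfl (g := fun _ => (Finset.univ.filter fun b : Equiv.Perm (Fin m) =>
      ∀ k, k.val < i ↔ b k ∈ A).card)]
  · simp
  intro B hB
  rw [card_perm_iff_mem_eq_of_card_eq i (hA.trans (Finset.mem_powersetCard.1 hB).2.symm)]
  congr 1
  refine Finset.filter_congr fun b _ => ?_
  rw [Finset.ext_iff, ← b.forall_congr_right]
  refine forall_congr' fun k => ?_
  simp [L]

/-! ### Weighted counts of assignments -/

theorem count_map_univ {m n : ℕ} (s : Fin m → Fin n) (j : Fin n) :
    ((Finset.univ : Finset (Fin m)).val.map s).count j = ballsIn s {j} := by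
  simp only [Multiset.count_map, ballsIn, Finset.mem_singleton, Finset.card_def, Finset.filter_val]
  simp only [eq_comm]

theorem ballsIn_comp_perm {m n : ℕ} (s : Fin m → Fin n) (b : Equiv.Perm (Fin m))
    (S : Finset (Fin n)) : ballsIn (s ∘ b) S = ballsIn s S := by
  refine Finset.card_bijective b b.bijective fun k => ?_
  simp

section Regularization

variable {m n : ℕ}

/-- Coefficients, in the exponents of the urns, of a positive deformation of the generating
polynomial `∏ᵢ (∑ⱼ p i j * xⱼ)` of the balls, restricted to the exponents where all `E j` vanish.
The factors `ε ^ (count - 1)` penalize a ball that is used twice, and the factors `ε ^ E j` penalize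
forbidden loads of urn `j`. -/
noncomputable def deformedCoeffs (p : Fin m → Fin n → ℝ) (E : Fin n → ℕ → ℕ) (ε : ℝ) :
    Multiset (Fin n) → ℝ :=
  fun s => (s.map fun j i => p i j + ε).foldr dirDeriv (fun u => ∏ i, ε ^ (u.count i - 1)) 0 *
    ∏ j, ε ^ E j (s.count j)

theorem pow_mul_pow_le_sq {E : ℕ → ℕ} (hE : ∀ k, 2 * E (k + 1) ≤ E k + E (k + 2)) {ε : ℝ}
    (h0 : 0 < ε) (h1 : ε ≤ 1) (k : ℕ) : ε ^ E k * ε ^ E (k + 2) ≤ (ε ^ E (k + 1)) ^ 2 := by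
  rw [← pow_add, ← pow_mul, mul_comm (E (k + 1))]
  exact pow_le_pow_of_le_one h0.le h1 (hE k)

theorem lorentzianCoeffs_deformedCoeffs [NeZero m] {p : Fin m → Fin n → ℝ} (hp : ∀ i j, 0 ≤ p i j)
    {E : Fin n → ℕ → ℕ} (hE : ∀ j k, 2 * E j (k + 1) ≤ E j k + E j (k + 2)) {ε : ℝ}
    (h0 : 0 < ε) (h1 : ε ≤ 1) : LorentzianCoeffs (deformedCoeffs p E ε) := by
  have hballs : LorentzianCoeffs fun u : Multiset (Fin m) => ∏ i, ε ^ (u.count i - 1) := by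
    have h := lorentzianCoeffs_one.mul_prod (w := fun (_ : Fin m) k => ε ^ (k - 1))
      (fun _ _ => by positivity)
      (fun _ k => pow_mul_pow_le_sq (E := fun k => k - 1) (fun k => by lia) h0 h1 k)
    simpa only [one_mul] using h
  exact (hballs.comp (p := fun j i => p i j + ε) fun j i => by linarith [hp i j]).mul_prod
    (w := fun j k => ε ^ E j k) (fun _ _ => by positivity)
    (fun j k => pow_mul_pow_le_sq (hE j) h0 h1 k)

/-- The mixed derivative of the deformed polynomial: `i` times in the direction of the urns of `S`
and `m - i` times in the direction of the other urns. -/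
noncomputable def mixedDeriv (p : Fin m → Fin n → ℝ) (E : Fin n → ℕ → ℕ) (S : Finset (Fin n))
    (i : ℕ) (ε : ℝ) : ℝ :=
  (Multiset.replicate i (fun j => (if j ∈ S then 1 else 0) + ε) +
    Multiset.replicate (m - i) (fun j => (if j ∈ S then 0 else 1) + ε)).foldr dirDeriv
      (deformedCoeffs p E ε) 0

theorem mixedDeriv_mul_le_sq {p : Fin m → Fin n → ℝ} (hp : ∀ i j, 0 ≤ p i j)
    {E : Fin n → ℕ → ℕ} (hE : ∀ j k, 2 * E j (k + 1) ≤ E j k + E j (k + 2)) (S : Finset (Fin n))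
    [Nonempty (Fin n)] {i : ℕ} (hi : 1 ≤ i) (him : i + 1 ≤ m) {ε : ℝ} (h0 : 0 < ε) (h1 : ε ≤ 1) :
    mixedDeriv p E S (i - 1) ε * mixedDeriv p E S (i + 1) ε ≤ mixedDeriv p E S i ε ^ 2 := by
  have : NeZero m := ⟨by lia⟩
  have h := (lorentzianCoeffs_deformedCoeffs hp hE h0 h1).mul_le_sq
    (z := fun j => (if j ∈ S then 1 else 0) + ε) (y := fun j => (if j ∈ S then 0 else 1) + ε)
    (fun j => by split_ifs <;> linarith) (fun j => by split_ifs <;> linarith) (i - 1) (m - i - 1)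
  rwa [show i - 1 + 1 = i by lia, show i - 1 + 2 = i + 1 by lia,
    show m - i - 1 + 2 = m - (i - 1) by lia, show m - i - 1 + 1 = m - i by lia,
    show m - i - 1 = m - (i + 1) by lia] at h

theorem map_ite_lt_univ {α : Type*} {i : ℕ} (hi : i ≤ m) (z y : α) :
    ((Finset.univ : Finset (Fin m)).val.map fun k => if k.val < i then z else y) =
      Multiset.replicate i z + Multiset.replicate (m - i) y := by
  obtain ⟨r, rfl⟩ := Nat.exists_eq_add_of_le hi
  rw [Fin.univ_val_map, List.ofFn_add]
  simp [List.ofFn_const, ← Multiset.coe_add, Multiset.coe_replicate]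

theorem mixedDeriv_eq_sum (p : Fin m → Fin n → ℝ) (E : Fin n → ℕ → ℕ) (S : Finset (Fin n))
    {i : ℕ} (hi : i ≤ m) (ε : ℝ) :
    mixedDeriv p E S i ε = ∑ s : Fin m → Fin n,
      (∏ k : Fin m, ((if k.val < i ↔ s k ∈ S then 1 else 0) + ε)) *
        ((∑ b : Fin m → Fin m, (∏ k, (p (b k) (s k) + ε)) * ∏ l, ε ^ (ballsIn b {l} - 1)) *
          ∏ j, ε ^ E j (ballsIn s {j})) := by
  rw [mixedDeriv, ← map_ite_lt_univ hi, foldr_dirDeriv_eq_sum]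
  refine Finset.sum_congr rfl fun s _ => ?_
  congr 1
  · refine Finset.prod_congr rfl fun k _ => ?_
    by_cases h1 : k.val < i <;> by_cases h2 : s k ∈ S <;> simp [h1, h2]
  · simp only [deformedCoeffs, add_zero, Multiset.map_map, count_map_univ]
    rw [show ((fun (j : Fin n) (i : Fin m) => p i j + ε) ∘ s) = fun k i => p i (s k) + ε from rfl,
      foldr_dirDeriv_eq_sum]
    simp only [add_zero, count_map_univ]

theorem continuous_mixedDeriv (p : Fin m → Fin n → ℝ) (E : Fin n → ℕ → ℕ) (S : Finset (Fin n))
    {i : ℕ} (hi : i ≤ m) : Continuous (mixedDeriv p E S i) := by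
  rw [funext (mixedDeriv_eq_sum p E S hi)]
  fun_prop

/-- The total weight `∏ b, p b (s b)` of the assignments `s` of balls to urns that put exactly `i`
balls into `S` and make all penalties `E j` vanish. -/
noncomputable def levelWeight (p : Fin m → Fin n → ℝ) (E : Fin n → ℕ → ℕ) (S : Finset (Fin n))
    (i : ℕ) : ℝ :=
  ∑ s : Fin m → Fin n with ballsIn s S = i ∧ ∀ j, E j (ballsIn s {j}) = 0, ∏ b, p b (s b)

theorem prod_zero_pow_ballsIn (b : Fin m → Fin m) :
    ∏ l, (0 : ℝ) ^ (ballsIn b {l} - 1) = if Function.Injective b then 1 else 0 := by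
  split_ifs with h
  · refine Finset.prod_eq_one fun l _ => ?_
    have : ballsIn b {l} ≤ 1 := Finset.card_le_one.2 fun x hx y hy => h (by
      simp only [Finset.mem_filter, Finset.mem_singleton] at hx hy
      rw [hx.2, hy.2])
    rw [show ballsIn b {l} - 1 = 0 by lia, pow_zero]
  · simp only [Function.Injective, not_forall] at h
    obtain ⟨x, y, hxy, hne⟩ := h
    have : 1 < ballsIn b {b x} := Finset.one_lt_card.2 ⟨x, by simp, y, by simp [hxy], hne⟩
    exact Finset.prod_eq_zero (Finset.mem_univ (b x)) (zero_pow (by lia))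

theorem prod_zero_pow_eq_ite {E : Fin n → ℕ → ℕ} (s : Fin m → Fin n) :
    ∏ j, (0 : ℝ) ^ E j (ballsIn s {j}) = if ∀ j, E j (ballsIn s {j}) = 0 then 1 else 0 := by
  split_ifs with h
  · exact Finset.prod_eq_one fun j _ => by rw [h j, pow_zero]
  · push Not at h
    obtain ⟨j, hj⟩ := h
    exact Finset.prod_eq_zero (Finset.mem_univ j) (zero_pow hj)

/-- Without deformation, the mixed derivative counts every assignment once for each ordering of the
balls that lists the balls in `S` first. -/
theorem mixedDeriv_zero (p : Fin m → Fin n → ℝ) (E : Fin n → ℕ → ℕ) (S : Finset (Fin n))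
    {i : ℕ} (hi : i ≤ m) :
    mixedDeriv p E S i 0 = m.factorial * (levelWeight p E S i / m.choose i) := by
  rw [mixedDeriv_eq_sum p E S hi]
  simp only [add_zero, prod_zero_pow_ballsIn, prod_zero_pow_eq_ite, Finset.prod_ite_zero,
    Finset.prod_const_one, Finset.mem_univ, true_implies]
  have h1 : ∀ s : Fin m → Fin n, ∑ b : Fin m → Fin m, (∏ k, p (b k) (s k)) *
      (if Function.Injective b then (1 : ℝ) else 0) =
      ∑ b : Equiv.Perm (Fin m), ∏ k, p (b k) (s k) := by
    intro s
    refine (Fintype.sum_of_injective (fun b : Equiv.Perm (Fin m) => (b : Fin m → Fin m))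
      DFunLike.coe_injective _ _ (fun b hb => ?_) fun b => ?_).symm
    · rw [if_neg, mul_zero]
      exact fun h => hb ⟨Equiv.ofBijective b (Finite.injective_iff_bijective.1 h), rfl⟩
    · rw [if_pos b.injective, mul_one]
  simp only [h1, Finset.sum_mul, Finset.mul_sum]
  rw [Finset.sum_comm]
  have h2 : ∀ b : Equiv.Perm (Fin m), ∑ s : Fin m → Fin n,
      (if ∀ k : Fin m, k.val < i ↔ s k ∈ S then (1 : ℝ) else 0) * ((∏ k, p (b k) (s k)) *
        if ∀ j, E j (ballsIn s {j}) = 0 then 1 else 0) =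
      ∑ s : Fin m → Fin n, (if ∀ k : Fin m, k.val < i ↔ s (b k) ∈ S then (1 : ℝ) else 0) *
        ((∏ k, p k (s k)) * if ∀ j, E j (ballsIn s {j}) = 0 then 1 else 0) := by
    intro b
    rw [← (Equiv.arrowCongr b (Equiv.refl (Fin n))).symm.sum_comp]
    refine Finset.sum_congr rfl fun s _ => ?_
    have h3 : (Equiv.arrowCongr b (Equiv.refl (Fin n))).symm s = s ∘ b := rfl
    rw [h3]
    simp only [ballsIn_comp_perm, Function.comp_apply]
    rw [Equiv.prod_comp b fun k => p k (s k)]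
  simp only [h2]
  rw [Finset.sum_comm, levelWeight, Finset.sum_div, Finset.mul_sum, Finset.sum_filter]
  refine Finset.sum_congr rfl fun s _ => ?_
  rw [← Finset.sum_mul]
  set A : Finset (Fin m) := Finset.univ.filter fun k => s k ∈ S with hA
  have hcard : A.card = ballsIn s S := rfl
  have h4 : ∑ b : Equiv.Perm (Fin m),
      (if ∀ k : Fin m, k.val < i ↔ s (b k) ∈ S then (1 : ℝ) else 0) =
      ((Finset.univ.filter fun b : Equiv.Perm (Fin m) => ∀ k, k.val < i ↔ b k ∈ A).card : ℝ) := by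
    rw [Finset.sum_boole]
    simp [hA]
  rw [h4]
  by_cases hs : ballsIn s S = i
  · have h5 : (m.choose i : ℝ) ≠ 0 := by exact_mod_cast (Nat.choose_pos hi).ne'
    rw [← choose_mul_card_perm_iff_mem hi (hcard.trans hs)]
    push_cast
    by_cases h6 : ∀ j, E j (ballsIn s {j}) = 0
    · rw [if_pos h6, if_pos ⟨hs, h6⟩]; field_simp
    · rw [if_neg h6, if_neg fun h => h6 h.2]; simp
  · have h5 : (Finset.univ.filter fun b : Equiv.Perm (Fin m) => ∀ k, k.val < i ↔ b k ∈ A) = ∅ := by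
      refine Finset.filter_eq_empty_iff.2 fun b _ hb => hs ?_
      rw [← hcard, ← Finset.card_bijective b b.bijective
        (s := Finset.univ.filter fun k => k.val < i) (fun k => by simp [← hb k]),
        Fin.card_filter_val_lt, min_eq_right hi]
    rw [h5, Finset.card_empty, Nat.cast_zero, zero_mul, if_neg fun h => hs h.1]

/-- Ultra-log-concavity of the level weights, by letting the deformation parameter tend to `0`. -/
theorem levelWeight_mul_le_sq {p : Fin m → Fin n → ℝ} (hp : ∀ i j, 0 ≤ p i j)
    {E : Fin n → ℕ → ℕ} (hE : ∀ j k, 2 * E j (k + 1) ≤ E j k + E j (k + 2)) (S : Finset (Fin n))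
    [Nonempty (Fin n)] {i : ℕ} (hi : 1 ≤ i) (him : i + 1 ≤ m) :
    levelWeight p E S (i - 1) / m.choose (i - 1) * (levelWeight p E S (i + 1) / m.choose (i + 1)) ≤
      (levelWeight p E S i / m.choose i) ^ 2 := by
  have hlim : ∀ l ≤ m, Filter.Tendsto (mixedDeriv p E S l) (nhdsWithin 0 (Set.Ioc 0 1))
      (nhds (mixedDeriv p E S l 0)) := fun l hl =>
    (continuous_mixedDeriv p E S hl).continuousAt.tendsto.mono_left nhdsWithin_le_nhds
  have hne : (nhdsWithin (0 : ℝ) (Set.Ioc 0 1)).NeBot := by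
    rw [nhdsWithin_Ioc_eq_nhdsGT one_pos]; infer_instance
  have h := le_of_tendsto_of_tendsto ((hlim (i - 1) (by lia)).mul (hlim (i + 1) him))
    ((hlim i (by lia)).pow 2) (by
      filter_upwards [self_mem_nhdsWithin] with ε hε
      exact mixedDeriv_mul_le_sq hp hE S hi him hε.1 hε.2)
  rw [mixedDeriv_zero p E S him, mixedDeriv_zero p E S (by lia : i ≤ m),
    mixedDeriv_zero p E S (by lia : i - 1 ≤ m), mul_mul_mul_comm, mul_pow, ← sq] at h
  exact le_of_mul_le_mul_left h (by positivity)

end Regularization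

/-! ### Exchange of balls between two admissible assignments -/

section Exchange

variable {m n : ℕ}

theorem ballsIn_update (s : Fin m → Fin n) (b : Fin m) (u : Fin n) (T : Finset (Fin n)) :
    ballsIn (Function.update s b u) T + (if s b ∈ T then 1 else 0) =
      ballsIn s T + (if u ∈ T then 1 else 0) := by
  rw [ballsIn, ballsIn, Finset.card_filter, Finset.card_filter,
    ← Finset.add_sum_erase _ _ (Finset.mem_univ b),
    ← Finset.add_sum_erase _ (fun i => if s i ∈ T then 1 else 0) (Finset.mem_univ b),
    Function.update_self, Finset.sum_congr rfl (fun i hi => by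
      rw [Function.update_of_ne (Finset.ne_of_mem_erase hi)] :
      ∀ i ∈ Finset.univ.erase b, (if Function.update s b u i ∈ T then 1 else 0) =
        if s i ∈ T then 1 else 0)]
  lia

theorem hammingDist_update_lt {s s' : Fin m → Fin n} {b : Fin m} (hb : s b ≠ s' b) :
    hammingDist (Function.update s b (s' b)) s' < hammingDist s s' := by
  refine Finset.card_lt_card (Finset.ssubset_iff_of_subset (fun i hi => ?_) |>.2 ⟨b, ?_, ?_⟩)
  · rcases eq_or_ne i b with rfl | h
    · simp at hi
    · simpa [Function.update_of_ne h] using hi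
  · simpa using hb
  · simp

theorem exists_mem_notMem_of_ballsIn_lt {s s' : Fin m → Fin n} {T : Finset (Fin n)}
    (h : ballsIn s T < ballsIn s' T) : ∃ b, s' b ∈ T ∧ s b ∉ T := by
  by_contra! hcon
  exact h.not_ge (Finset.card_le_card fun b hb => by
    simp only [Finset.mem_filter, Finset.mem_univ, true_and] at hb ⊢
    exact hcon b hb)

/-- Every ball `b` is in an urn allowed by `P b`, and the loads of the urns in `K` are in the
intervals `[lo j, hi j)`. -/
structure IsAdmissible (P : Fin m → Fin n → Prop) (K : Finset (Fin n)) (lo hi : Fin n → ℕ)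
    (s : Fin m → Fin n) : Prop where
  allowed : ∀ b, P b (s b)
  load : ∀ j ∈ K, lo j ≤ ballsIn s {j} ∧ ballsIn s {j} < hi j

variable {P : Fin m → Fin n → Prop} {K : Finset (Fin n)} {lo hi : Fin n → ℕ}

/-- An assignment `s` that misses admissibility by one ball, lacking in urn `v`, is repaired by
moving balls to the urns they have in the admissible assignment `s'`. Filling the gap in `v` may
open a gap in another urn of `K`, which is then filled in turn; the process ends in an urn of `K`
with a spare ball, or outside `K`. -/
theorem exists_isAdmissible_of_lack (N : ℕ) {s s' : Fin m → Fin n} (hs' : IsAdmissible P K lo hi s')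
    (hN : hammingDist s s' ≤ N) (hs : ∀ b, P b (s b)) {v : Fin n} (hv : v ∈ K)
    (hlack : ballsIn s {v} + 1 = lo v) (hlt : lo v < hi v)
    (hload : ∀ j ∈ K, j ≠ v → lo j ≤ ballsIn s {j} ∧ ballsIn s {j} < hi j) :
    ∃ r, IsAdmissible P K lo hi r ∧ hammingDist r s' < hammingDist s s' ∧
      (ballsIn r Kᶜ = ballsIn s Kᶜ ∨ ballsIn r Kᶜ + 1 = ballsIn s Kᶜ) := by
  induction N generalizing s v with
  | zero =>
    have h : s = s' := hammingDist_eq_zero.1 (by lia)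
    have := (hs'.load v hv).1
    rw [← h] at this
    lia
  | succ N ih =>
    obtain ⟨b, hb', hb⟩ := exists_mem_notMem_of_ballsIn_lt (s := s) (s' := s') (T := {v})
      (by have := (hs'.load v hv).1; lia)
    rw [Finset.mem_singleton] at hb hb'
    have hdist := hammingDist_update_lt (s := s) (s' := s') (b := b) (by rwa [hb'])
    rw [hb'] at hdist
    have hallow : ∀ i, P i (Function.update s b v i) := fun i => by
      rcases eq_or_ne i b with rfl | h
      · rw [Function.update_self, ← hb']; exact hs'.allowed i
      · rw [Function.update_of_ne h]; exact hs i
    have hup : ∀ j, ballsIn (Function.update s b v) {j} + (if s b = j then 1 else 0) =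
        ballsIn s {j} + (if v = j then 1 else 0) := fun j => by
      simpa only [Finset.mem_singleton] using ballsIn_update s b v {j}
    have hupK := ballsIn_update s b v Kᶜ
    simp only [Finset.mem_compl, hv, not_true, if_false] at hupK
    -- all urns of `K` other than the one that lost the ball have admissible loads
    have hothers : ∀ j ∈ K, j ≠ s b →
        lo j ≤ ballsIn (Function.update s b v) {j} ∧
          ballsIn (Function.update s b v) {j} < hi j := by
      intro j hj hjb
      have h1 := hup j
      rw [if_neg hjb.symm] at h1
      rcases eq_or_ne j v with rfl | h
      · rw [if_pos rfl] at h1; lia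
      · rw [if_neg h.symm] at h1
        have := hload j hj h
        lia
    by_cases hK : s b ∈ K
    · have h1 := hup (s b)
      rw [if_pos rfl, if_neg (Ne.symm hb)] at h1
      have h2 := hload (s b) hK hb
      simp only [hK, not_true, if_false] at hupK
      by_cases h3 : lo (s b) ≤ ballsIn (Function.update s b v) {s b}
      · refine ⟨_, ⟨hallow, fun j hj => ?_⟩, hdist, Or.inl (by lia)⟩
        rcases eq_or_ne j (s b) with rfl | h
        · exact ⟨h3, by lia⟩
        · exact hothers j hj h
      · obtain ⟨r, hr, hrd, hrK⟩ := ih (s := Function.update s b v) (by lia) hallow hK (by lia)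
          (by lia) hothers
        exact ⟨r, hr, by lia, by lia⟩
    · simp only [hK, not_false_eq_true, if_true] at hupK
      exact ⟨_, ⟨hallow, fun j hj => hothers j hj fun h => hK (h ▸ hj)⟩, hdist, Or.inr (by lia)⟩

/-- The numbers of balls outside `K` in admissible assignments form an interval. -/
theorem exists_isAdmissible_ballsIn_eq (N : ℕ) {s s' : Fin m → Fin n}
    (hs : IsAdmissible P K lo hi s) (hs' : IsAdmissible P K lo hi s')
    (hN : hammingDist s s' ≤ N) {c : ℕ} (h1 : ballsIn s Kᶜ < c) (h2 : c < ballsIn s' Kᶜ) :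
    ∃ r, IsAdmissible P K lo hi r ∧ ballsIn r Kᶜ = c := by
  induction N generalizing s with
  | zero =>
    have h : s = s' := hammingDist_eq_zero.1 (by lia)
    rw [h] at h1
    lia
  | succ N ih =>
    -- one step towards `s'` raises the number of balls outside `K` by at most one
    suffices h : ∃ r, IsAdmissible P K lo hi r ∧ hammingDist r s' < hammingDist s s' ∧
        ballsIn r Kᶜ ≤ ballsIn s Kᶜ + 1 by
      obtain ⟨r, hr, hrd, hrK⟩ := h
      rcases eq_or_ne (ballsIn r Kᶜ) c with h | h
      · exact ⟨r, hr, h⟩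
      · exact ih hr (by lia) (by lia)
    obtain ⟨b, hb', hb⟩ := exists_mem_notMem_of_ballsIn_lt (h1.trans h2)
    rw [Finset.mem_compl, not_not] at hb
    have hb'' := Finset.mem_compl.1 hb'
    have hne : s b ≠ s' b := fun h => hb'' (h ▸ hb)
    have hdist := hammingDist_update_lt hne
    have hallow : ∀ i, P i (Function.update s b (s' b) i) := fun i => by
      rcases eq_or_ne i b with rfl | h
      · rw [Function.update_self]; exact hs'.allowed i
      · rw [Function.update_of_ne h]; exact hs.allowed i
    have hupK := ballsIn_update s b (s' b) Kᶜ
    simp only [Finset.mem_compl, hb, hb'', not_true, not_false_eq_true, if_false, if_true] at hupK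
    have hup : ∀ j ∈ K, ballsIn (Function.update s b (s' b)) {j} + (if s b = j then 1 else 0) =
        ballsIn s {j} := fun j hj => by
      have h := ballsIn_update s b (s' b) {j}
      simp only [Finset.mem_singleton] at h
      rwa [if_neg (c := s' b = j) fun h => hb'' (h ▸ hj), add_zero] at h
    have hothers : ∀ j ∈ K, j ≠ s b → lo j ≤ ballsIn (Function.update s b (s' b)) {j} ∧
        ballsIn (Function.update s b (s' b)) {j} < hi j := by
      intro j hj hjb
      have h3 := hup j hj
      rw [if_neg hjb.symm, add_zero] at h3
      rw [h3]
      exact hs.load j hj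
    have h3 := hup (s b) hb
    rw [if_pos rfl] at h3
    have h4 := hs.load (s b) hb
    by_cases h5 : lo (s b) ≤ ballsIn (Function.update s b (s' b)) {s b}
    · refine ⟨_, ⟨hallow, fun j hj => ?_⟩, hdist, by lia⟩
      rcases eq_or_ne j (s b) with rfl | h
      · exact ⟨h5, by lia⟩
      · exact hothers j hj h
    · obtain ⟨r, hr, hrd, hrK⟩ := exists_isAdmissible_of_lack _ hs' le_rfl hallow hb (by lia)
        (by lia) hothers
      exact ⟨r, hr, by lia, by lia⟩

end Exchange

/-! ### The conditional law -/

section Law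

variable {Ω : Type*} [MeasurableSpace Ω] {m n : ℕ}

theorem measureReal_assignment_eq_prod {μ : Measure Ω} {σ : Fin m → Ω → Fin n}
    (hindep : iIndepFun σ μ) (s : Fin m → Fin n) :
    μ.real ((fun ω i => σ i ω) ⁻¹' {s}) = ∏ i, μ.real (σ i ⁻¹' {s i}) := by
  have h := hindep.measure_inter_preimage_eq_mul Finset.univ (sets := fun i => {s i})
    fun i _ => measurableSet_singleton _
  have hset : (fun ω i => σ i ω) ⁻¹' {s} = ⋂ i ∈ (Finset.univ : Finset (Fin m)), σ i ⁻¹' {s i} := by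
    ext ω
    simp [funext_iff]
  rw [measureReal_def, hset, h, ENNReal.toReal_prod]
  rfl

/-- The distance of the load `k` of urn `j` to the interval `[lo j, hi j)`, for `j ∈ K`. -/
def intervalPenalty (K : Finset (Fin n)) (lo hi : Fin n → ℕ) (j : Fin n) (k : ℕ) : ℕ :=
  if j ∈ K then (lo j - k) + (k + 1 - hi j) else 0

theorem intervalPenalty_convex {K : Finset (Fin n)} {lo hi : Fin n → ℕ} (j : Fin n) (k : ℕ) :
    2 * intervalPenalty K lo hi j (k + 1) ≤
      intervalPenalty K lo hi j k + intervalPenalty K lo hi j (k + 2) := by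
  unfold intervalPenalty
  split_ifs <;> lia

theorem intervalPenalty_eq_zero {K : Finset (Fin n)} {lo hi : Fin n → ℕ} {s : Fin m → Fin n} :
    (∀ j, intervalPenalty K lo hi j (ballsIn s {j}) = 0) ↔
      ∀ j ∈ K, lo j ≤ ballsIn s {j} ∧ ballsIn s {j} < hi j := by
  refine forall_congr' fun j => ?_
  unfold intervalPenalty
  split_ifs with h
  · simp only [h, true_implies]; lia
  · simp [h]

theorem measureReal_cond_map_ballsIn {μ : Measure Ω} [IsProbabilityMeasure μ]
    {σ : Fin m → Ω → Fin n} (hσ : ∀ i, Measurable (σ i)) (hindep : iIndepFun σ μ)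
    (S K : Finset (Fin n)) {k : Fin n → ℕ} (a : ∀ j, Fin (k j + 1) → ℕ) (t : ∀ j, Fin (k j))
    (i : ℕ) :
    ((cond μ (intervalEvent σ K a t)).map fun ω => ballsIn (fun i => σ i ω) S).real {i} =
      (μ.real (intervalEvent σ K a t))⁻¹ * levelWeight (fun b j => μ.real (σ b ⁻¹' {j}))
        (intervalPenalty K (fun j => a j (t j).castSucc) fun j => a j (t j).succ) S i := by
  have hX : Measurable fun ω i => σ i ω := measurable_pi_lambda _ hσ
  have hmeas : ∀ T : Set (Fin m → Fin n), MeasurableSet ((fun ω i => σ i ω) ⁻¹' T) :=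
    fun T => hX T.toFinite.measurableSet
  have hQ : MeasurableSet (intervalEvent σ K a t) :=
    hmeas {s | ∀ j ∈ K, HasLevel (a j) s j (t j)}
  have hZ : Measurable fun ω => ballsIn (fun i => σ i ω) S :=
    fun T _ => hmeas {s | ballsIn s S ∈ T}
  rw [map_measureReal_apply hZ (measurableSet_singleton i), measureReal_def, cond_apply hQ,
    ENNReal.toReal_mul, ENNReal.toReal_inv, ← measureReal_def, ← measureReal_def]
  congr 1
  rw [levelWeight]
  simp only [← measureReal_assignment_eq_prod hindep]
  rw [sum_measureReal_preimage_singleton _ fun s _ => hmeas {s}]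
  congr 1
  ext ω
  simp only [Set.mem_inter_iff, Set.mem_preimage, Set.mem_singleton_iff, Finset.coe_filter,
    Finset.mem_univ, true_and, Set.mem_ofPred_eq, intervalPenalty_eq_zero]
  exact and_comm

theorem levelWeight_ne_zero_iff {p : Fin m → Fin n → ℝ} (hp : ∀ i j, 0 ≤ p i j)
    {K : Finset (Fin n)} {lo hi : Fin n → ℕ} {i : ℕ} :
    levelWeight p (intervalPenalty K lo hi) Kᶜ i ≠ 0 ↔
      ∃ s, IsAdmissible (fun b j => p b j ≠ 0) K lo hi s ∧ ballsIn s Kᶜ = i := by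
  rw [levelWeight, Ne, Finset.sum_eq_zero_iff_of_nonneg fun s _ =>
    Finset.prod_nonneg fun b _ => hp b (s b)]
  push Not
  refine exists_congr fun s => ?_
  rw [Finset.mem_filter, intervalPenalty_eq_zero, Finset.prod_ne_zero_iff]
  exact ⟨fun ⟨⟨_, h1, h2⟩, h3⟩ => ⟨⟨fun b => h3 b (Finset.mem_univ b), h2⟩, h1⟩,
    fun ⟨⟨h3, h2⟩, h1⟩ => ⟨⟨Finset.mem_univ s, h1, h2⟩, fun b _ => h3 b⟩⟩

theorem levelWeight_eq_zero_of_lt {p : Fin m → Fin n → ℝ} {E : Fin n → ℕ → ℕ}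
    {S : Finset (Fin n)} {i : ℕ} (hi : m < i) : levelWeight p E S i = 0 := by
  refine Finset.sum_eq_zero fun s hs => ?_
  have h1 := (Finset.mem_filter.1 hs).2.1
  have h2 : ballsIn s S ≤ m := (Finset.card_le_univ _).trans_eq (Fintype.card_fin m)
  lia

/-- Ultra-log-concavity implies strong log-concavity, since
`C(m, i-1) * C(m, i+1) / C(m, i) ^ 2 = (i / (i + 1)) * ((m - i) / (m - i + 1))`. -/
theorem IsUltraLogConcave.isStronglyLogConcave {ν : Measure ℕ} (h : IsUltraLogConcave m ν)
    (hν : ∀ i, m < i → ν.real {i} = 0) : IsStronglyLogConcave ν := by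
  intro i hi
  rcases Nat.lt_or_ge m (i + 1) with hm | hm
  · rw [hν _ hm, mul_zero]
    exact mul_nonneg (Nat.cast_nonneg i) (sq_nonneg _)
  have h1 := h.1 i hi hm
  obtain ⟨i, rfl⟩ := Nat.exists_eq_add_of_le' hi
  obtain ⟨r, rfl⟩ := Nat.exists_eq_add_of_le' hm
  rw [Nat.add_sub_cancel] at h1 ⊢
  have e1 := Nat.choose_succ_right_eq (r + (i + 1 + 1)) i
  have e2 := Nat.choose_succ_right_eq (r + (i + 1 + 1)) (i + 1)
  rw [show r + (i + 1 + 1) - i = r + 2 by lia] at e1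
  rw [show r + (i + 1 + 1) - (i + 1) = r + 1 by lia] at e2
  have p0 : 0 < ((r + (i + 1 + 1)).choose i : ℝ) := by
    exact_mod_cast Nat.choose_pos (by lia)
  have p1 : 0 < ((r + (i + 1 + 1)).choose (i + 1) : ℝ) := by
    exact_mod_cast Nat.choose_pos (by lia)
  have p2 : 0 < ((r + (i + 1 + 1)).choose (i + 1 + 1) : ℝ) := by
    exact_mod_cast Nat.choose_pos (by lia)
  have f1 : ((r + (i + 1 + 1)).choose (i + 1) : ℝ) * (i + 1) =
    (r + (i + 1 + 1)).choose i * (r + 2) := by exact_mod_cast e1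
  have f2 : ((r + (i + 1 + 1)).choose (i + 1 + 1) : ℝ) * (i + 1 + 1) =
    (r + (i + 1 + 1)).choose (i + 1) * (r + 1) := by exact_mod_cast e2
  push_cast
  set c0 : ℝ := ((r + (i + 1 + 1)).choose i : ℝ)
  set c1 : ℝ := ((r + (i + 1 + 1)).choose (i + 1) : ℝ)
  set c2 : ℝ := ((r + (i + 1 + 1)).choose (i + 1 + 1) : ℝ)
  set x := ν.real {i}
  set y := ν.real {i + 1}
  set z := ν.real {i + 1 + 1}
  rw [div_mul_div_comm, div_pow, div_le_div_iff₀ (by positivity) (by positivity)] at h1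
  have hc : c0 * c2 * (i + 1 + 1) ≤ c1 ^ 2 * (i + 1) := by
    have : c0 * c2 * (i + 1 + 1) = c0 * c1 * (r + 1) := by rw [mul_assoc, f2]; ring
    rw [this]
    have : c1 ^ 2 * (i + 1) = c0 * c1 * (r + 2) := by rw [sq, mul_assoc, f1]; ring
    rw [this]
    have := mul_pos p0 p1
    nlinarith
  have h2 : c1 ^ 2 * ((i + 1 + 1) * x * z) ≤ c1 ^ 2 * ((i + 1) * y ^ 2) := by
    have h3 := mul_le_mul_of_nonneg_left hc (sq_nonneg y)
    have h4 := mul_le_mul_of_nonneg_right h1 (by positivity : (0 : ℝ) ≤ i + 1 + 1)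
    linarith
  exact le_of_mul_le_mul_left h2 (by positivity)

end Law

theorem mainTheorem5 {Ω : Type*} [MeasurableSpace Ω] (μ : Measure Ω) [IsProbabilityMeasure μ]
    (m n : ℕ) (σ : Fin m → Ω → Fin n) (hσ : ∀ i, Measurable (σ i)) (hindep : iIndepFun σ μ)
    (I J K : Finset (Fin n)) (hIJ : Disjoint I J) (hIK : Disjoint I K) (hJK : Disjoint J K)
    (hcover : I ∪ J ∪ K = Finset.univ)
    (k : Fin n → ℕ) (a : ∀ j, Fin (k j + 1) → ℕ) (ha : ∀ j, IsBreakpoints m (a j))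
    (t : ∀ j, Fin (k j)) (hQ : μ (intervalEvent σ K a t) ≠ 0) :
    IsUltraLogConcave m
        ((cond μ (intervalEvent σ K a t)).map fun ω => ballsIn (fun i => σ i ω) (I ∪ J)) ∧
      IsStronglyLogConcave
        ((cond μ (intervalEvent σ K a t)).map fun ω => ballsIn (fun i => σ i ω) (I ∪ J)) := by
  have hS : I ∪ J = Kᶜ := by
    rw [eq_compl_iff_isCompl]
    exact ⟨Finset.disjoint_union_left.2 ⟨hIK, hJK⟩, codisjoint_iff.2 hcover⟩
  rw [hS]
  set ν := (cond μ (intervalEvent σ K a t)).map fun ω => ballsIn (fun i => σ i ω) Kᶜ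
  set p : Fin m → Fin n → ℝ := fun b j => μ.real (σ b ⁻¹' {j}) with hpdef
  have hp : ∀ i j, 0 ≤ p i j := fun _ _ => measureReal_nonneg
  have hν : ∀ i, ν.real {i} = (μ.real (intervalEvent σ K a t))⁻¹ * levelWeight p
      (intervalPenalty K (fun j => a j (t j).castSucc) fun j => a j (t j).succ) Kᶜ i :=
    measureReal_cond_map_ballsIn hσ hindep Kᶜ K a t
  have hq : μ.real (intervalEvent σ K a t) ≠ 0 := by
    rw [measureReal_def]
    exact ENNReal.toReal_ne_zero.2 ⟨hQ, measure_ne_top μ _⟩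
  have hULC : IsUltraLogConcave m ν := by
    constructor
    · intro i hi him
      have : Nonempty (Fin n) := by
        obtain ⟨ω⟩ : Nonempty Ω := nonempty_of_isProbabilityMeasure μ
        exact ⟨σ ⟨0, by lia⟩ ω⟩
      have h := levelWeight_mul_le_sq hp (E := intervalPenalty K (fun j => a j (t j).castSucc)
        fun j => a j (t j).succ) intervalPenalty_convex Kᶜ hi him
      simp only [hν, mul_div_assoc]
      rw [mul_mul_mul_comm, mul_pow, ← sq]
      exact mul_le_mul_of_nonneg_left h (sq_nonneg _)
    · intro i j l hij hjl hlm hi hl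
      have hiff : ∀ c ≤ m, ν.real {c} / (m.choose c : ℝ) ≠ 0 ↔
          ∃ s, IsAdmissible (fun b j => p b j ≠ 0) K (fun j => a j (t j).castSucc)
            (fun j => a j (t j).succ) s ∧ ballsIn s Kᶜ = c := by
        intro c hc
        rw [← levelWeight_ne_zero_iff hp, hν, div_ne_zero_iff, mul_ne_zero_iff]
        have h1 : (m.choose c : ℝ) ≠ 0 := by exact_mod_cast (Nat.choose_pos hc).ne'
        simp [h1, hq]
      obtain ⟨s, hs, rfl⟩ := (hiff i (by lia)).1 hi
      obtain ⟨s', hs', rfl⟩ := (hiff l hlm).1 hl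
      exact (hiff j (by lia)).2 (exists_isAdmissible_ballsIn_eq _ hs hs' le_rfl hij hjl)
  exact ⟨hULC, hULC.isStronglyLogConcave fun i hi => by
    rw [hν, levelWeight_eq_zero_of_lt hi, mul_zero]⟩
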